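/- Let $N\ge 1$, and let $r\ge 2$, $h\ge 0$ be integers. Let $F(N;r,h)$ be the number of subsets $Y\subseteq\mathbb Z/N$ that contain exactly $h$ times $r$ consecutive integers modulo $N$, i.e. for which exactly $h$ elements $i\in\mathbb Z/N$ satisfy $i,i+1,\dots,i+r-1\in Y$. For a binary word $U$, let $T^{N-n,n}_h(U)$ be the number of binary sequences $(\alpha_i)_{i\in\mathbb Z/N}$ with $n$ ones and $N-n$ zeros such that $U=(\alpha_i,\alpha_{i+1},\dots,\alpha_{i+|U|-1})$ for exactly $h$ elements $i\in\mathbb Z/N$. For integers $s,i,g,j\ge 0$ put $$c^{(s)ig}_{j}=\frac1g\sum_{k=1}^{g}\ \sum_{f} k\binom{f_0}{f_1}\binom{f_1}{f_2}\cdots\binom{f_{s-1}}{f_s}\binom{f_s}{k}\binom gk\quad(g\ne 0),\qquad c^{(s)i0}_{j}=\sum_{f}\binom{f_0}{f_1}\cdots\binom{f_{s-1}}{f_s},$$ where $f$ runs over all chains of integers $j=f_0\ge f_1\ge\dots\ge f_s\ge 0$ with $f_0+f_1+\dots+f_s=i-g$ (an empty product is $1$). Write $[P]=1$ if $P$ holds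 and $[P]=0$ otherwise, and let $\binom ab=0$ if $b<0$. Then: 1. For all $r\ge 2$ and $h\ge 0$, $$F(N;r,h)=\sum_{n=0}^{N}T^{N-n,n}_h(\underbrace{1\cdots1}_{r})=N\sum_{n=0}^{N-1}\sum_{j=0}^{N-n}\frac{c^{(r-2)nh}_{j}}{N-n}\binom{N-n}{j}+[h=N].$$ 2. For all $h\ge 0$, $$F(N;2,h)=\sum_{n=h+1}^{\lfloor (N+h)/2\rfloor}\frac{(n-h)N}{(N-n)n}\binom{N-n}{n-h}\binom nh+[h=0]+[h=N].$$ 3. In particular, the corrected Fibonacci numbers are $$F(N;2,0)=1+\sum_{n=1}^{\lfloor N/2\rfloor}\frac{N}{N-n}\binom{N-n}{n}.$$ 4. The number of subsets of $\mathbb Z/N$ that do not contain three consecutive integers modulo $N$ is $$F(N;3,0)=N\sum_{n=0}^{N-1}\sum_{j=\lfloor n/2\rfloor}^{N-n}\frac{c^{(1)n0}_{j}}{N-n}\binom{N-n}{j}=1+N\sum_{\substack{1\le n<N\\ n+\lfloor n/2\rfloor\le N}}\ \sum_{j=\lfloor n/2\rfloor}^{N-n}\frac{\binom{j}{n-j}\binom{N-n}{j}}{N-n}.$$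 (The term $[h=N]$ accounts for the full set $\mathbb Z/N$; the term $[h=0]$ in 2 and the summand $1$ in 3 and 4 account for the empty subset.) -/

import Mathlib

namespace BinarySeq

/-- Number of positions `i` in `ℤ/N` at which the finite string `U` occurs in the cyclic binary
sequence `S`, i.e. `S i, S (i+1), …, S (i + |U| - 1)` is `U` (`true` is the digit 1). -/
def occurrences (N : ℕ) [NeZero N] (U : List Bool) (S : ZMod N → Bool) : ℕ :=
  (Finset.univ.filter fun i : ZMod N =>
    ∀ t : Fin U.length, S (i + ((t : ℕ) : ZMod N)) = U.get t).card

/-- The number `T^{N-n,n}_h(U)` of cyclic binary sequences of length `N` with `n` ones and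
`N - n` zeros in which the string `U` occurs exactly `h` times. -/
def stringCount (N : ℕ) [NeZero N] (n : ℕ) (U : List Bool) (h : ℕ) : ℕ :=
  (Finset.univ.filter fun S : ZMod N → Bool =>
    (Finset.univ.filter fun i : ZMod N => S i = true).card = n ∧ occurrences N U S = h).card

/-- Number of times a subset `Y` of `ℤ/N` contains `r` consecutive integers modulo `N`:
the number of starting points `i` with `i, i+1, …, i+r-1 ∈ Y`. -/
def consecutiveCount (N : ℕ) [NeZero N] (r : ℕ) (Y : Finset (ZMod N)) : ℕ :=
  (Finset.univ.filter fun i : ZMod N => ∀ t < r, i + (t : ZMod N) ∈ Y).card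

/-- The generalized corrected Fibonacci number `F(N; r, h)`: the number of all subsets of `ℤ/N`
that contain exactly `h` times `r` consecutive integers modulo `N`. -/
def genFib (N : ℕ) [NeZero N] (r h : ℕ) : ℕ :=
  (Finset.univ.filter fun Y : Finset (ZMod N) => consecutiveCount N r Y = h).card

/-- The chains `j = f 0 ≥ f 1 ≥ ⋯ ≥ f s` of natural numbers with `f 0 + f 1 + ⋯ + f s + g = i`. -/
def chains (s i g j : ℕ) : Finset (Fin (s + 1) → ℕ) :=
  (Fintype.piFinset fun _ : Fin (s + 1) => Finset.range (i + 1)).filter fun f =>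
    f 0 = j ∧ (∀ t : Fin s, f t.succ ≤ f t.castSucc) ∧ (∑ t, f t) + g = i

/-- The product `C(f 0, f 1) C(f 1, f 2) ⋯ C(f (s-1), f s)`. -/
def chainProd {s : ℕ} (f : Fin (s + 1) → ℕ) : ℕ :=
  ∏ t : Fin s, (f t.castSucc).choose (f t.succ)

/-- The coefficient `c^{(s) i g}_j`. -/
def coeffC (s i g j : ℕ) : ℚ :=
  if g = 0 then ∑ f ∈ chains s i 0 j, (chainProd f : ℚ)
  else (1 / (g : ℚ)) * ∑ k ∈ Finset.Icc 1 g, ∑ f ∈ chains s i g j,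
    (k : ℚ) * chainProd f * (f (Fin.last s)).choose k * g.choose k

end BinarySeq

/-! The proof rests on a double count of pairs (cyclic sequence, zero in it). By rotation
invariance, `(N - n) * T` equals `N` times the number of sequences with a zero at position 0
(`mul_stringCount`). Cutting at that zero leaves a linear word of length `N - 1` with the same ones
and the same occurrences, since no window can cross the zero (`cyclicRunCount_getD`).

A word with `n` ones and `L - n` zeros is a list of `L - n + 1` independent, possibly empty runs of
ones. A run of `a` ones contains `max (a - s) 0` windows of length `s + 1`, so words are counted by
a coefficient of `runSeries s ^ (L + 1 - n)` (`wordSum_eq_coeff`).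

Expanding `runSeries (s + 1) = 1 + X * runSeries s` binomially, level by level, produces the chains
of binomials. At the bottom, `runSeries 0` is `1 / (1 - x y)`, whose powers give the weight of the
last entry (`coeffC_eq_coeffXY`). The case `n = N` has no zero to cut at and supplies `[h = N]`. -/

namespace BinarySeq

/-! ### Generating series of a run of ones -/

/-- The generating series `∑ a, x ^ a * y ^ max (a - s) 0` of a run of ones: `x` marks the digits of
the run, `y` the occurrences of `s + 1` consecutive ones. -/
noncomputable def runSeries : ℕ → PowerSeries (Polynomial ℚ)
  | 0 => PowerSeries.mk fun n => Polynomial.X ^ n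
  | s + 1 => 1 + PowerSeries.X * runSeries s

theorem runSeries_zero_eq :
    runSeries 0 = 1 + PowerSeries.X * (PowerSeries.C Polynomial.X * runSeries 0) := by
  ext1 n
  cases n with
  | zero => simp [runSeries]
  | succ n => simp [runSeries, PowerSeries.coeff_succ_X_mul, PowerSeries.coeff_one, pow_succ']

theorem runSeries_succ_pow (s m : ℕ) :
    runSeries (s + 1) ^ m
      = ∑ j ∈ Finset.range (m + 1),
          ((m.choose j : ℕ) : PowerSeries (Polynomial ℚ)) *
            (PowerSeries.X ^ j * runSeries s ^ j) := by
  rw [runSeries, add_comm, add_pow]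
  refine Finset.sum_congr rfl fun j _ => ?_
  rw [mul_pow, one_pow]
  ring

/-- The coefficient of `x ^ n * y ^ h` in a power series in `x` with polynomial coefficients in
`y`. -/
noncomputable def coeffXY (n h : ℕ) (φ : PowerSeries (Polynomial ℚ)) : ℚ :=
  (PowerSeries.coeff n φ).coeff h

theorem coeffXY_sum {ι : Type*} (n h : ℕ) (s : Finset ι) (φ : ι → PowerSeries (Polynomial ℚ)) :
    coeffXY n h (∑ i ∈ s, φ i) = ∑ i ∈ s, coeffXY n h (φ i) := by
  simp [coeffXY]

theorem coeffXY_natCast_mul (n h a : ℕ) (φ : PowerSeries (Polynomial ℚ)) :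
    coeffXY n h ((a : PowerSeries (Polynomial ℚ)) * φ) = a * coeffXY n h φ := by
  simp [coeffXY, ← nsmul_eq_mul]

theorem coeffXY_X_pow_mul (n h j : ℕ) (φ : PowerSeries (Polynomial ℚ)) :
    coeffXY n h (PowerSeries.X ^ j * φ) = if j ≤ n then coeffXY (n - j) h φ else 0 := by
  rw [coeffXY, PowerSeries.coeff_X_pow_mul']
  split_ifs <;> simp [coeffXY]

/-- `runSeries 0` is the geometric series in `x y`, so this is the negative binomial expansion. For
`j = 0` truncated subtraction still gives the right value: 1 at `n = 0`, else 0. -/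
theorem coeffXY_runSeries_zero_pow (n h j : ℕ) :
    coeffXY n h (runSeries 0 ^ j) = if n = h then ((j + n - 1).choose n : ℚ) else 0 := by
  cases j with
  | zero =>
    rw [pow_zero, coeffXY, PowerSeries.coeff_one]
    cases n with
    | zero => simp [Polynomial.coeff_one, eq_comm]
    | succ n => simp
  | succ j =>
    have hr : runSeries 0
        = PowerSeries.rescale (Polynomial.X : Polynomial ℚ) (PowerSeries.mk 1) := by
      simp [runSeries, PowerSeries.rescale_mk]
    rw [hr, ← map_pow, PowerSeries.mk_one_pow_eq_mk_choose_add, PowerSeries.rescale_mk, coeffXY,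
      PowerSeries.coeff_mk, ← Polynomial.C_eq_natCast, mul_comm, Polynomial.coeff_C_mul_X_pow,
      show j + 1 + n - 1 = j + n by omega, Nat.choose_symm_add]
    simp [eq_comm]

/-! ### Chain sums as coefficients of the series -/

/-- The sum over chains of the product of binomial coefficients, weighted by a function of the last
entry. -/
noncomputable def chainSum (s i g j : ℕ) (φ : ℕ → ℚ) : ℚ :=
  ∑ f ∈ chains s i g j, (chainProd f : ℚ) * φ (f (Fin.last s))

/-- The weight of the last entry of a chain in `coeffC`. -/
noncomputable def lastWeight (g a : ℕ) : ℚ :=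
  if g = 0 then 1
  else (1 / (g : ℚ)) * ∑ k ∈ Finset.Icc 1 g, (k : ℚ) * a.choose k * g.choose k

theorem coeffC_eq_chainSum (s i g j : ℕ) :
    coeffC s i g j = chainSum s i g j (lastWeight g) := by
  unfold coeffC chainSum lastWeight
  split_ifs with hg
  · simp [hg]
  · rw [Finset.sum_comm, Finset.mul_sum]
    refine Finset.sum_congr rfl fun f _ => ?_
    rw [Finset.mul_sum, Finset.mul_sum, Finset.mul_sum]
    refine Finset.sum_congr rfl fun k _ => ?_
    ring

theorem mem_chains {s i g j : ℕ} {f : Fin (s + 1) → ℕ} :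
    f ∈ chains s i g j ↔
      f 0 = j ∧ (∀ t : Fin s, f t.succ ≤ f t.castSucc) ∧ (∑ t, f t) + g = i := by
  simp only [chains, Finset.mem_filter, Fintype.mem_piFinset, Finset.mem_range,
    and_iff_right_iff_imp]
  rintro ⟨-, -, h⟩ t
  have := Finset.single_le_sum (f := f) (fun _ _ => Nat.zero_le _) (Finset.mem_univ t)
  omega

theorem chainSum_zero (i g j : ℕ) (φ : ℕ → ℚ) :
    chainSum 0 i g j φ = if j + g = i then φ j else 0 := by
  have h : chains 0 i g j = if j + g = i then {fun _ => j} else ∅ := by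
    ext f
    rw [mem_chains]
    split_ifs with h
    · rw [Finset.mem_singleton]
      constructor
      · rintro ⟨h0, -, -⟩
        ext t
        rw [← h0, Fin.fin_one_eq_zero t]
      · rintro rfl
        exact ⟨rfl, fun t => t.elim0, h⟩
    · simp only [Finset.notMem_empty, iff_false]
      rintro ⟨h0, -, h1⟩
      apply h
      rw [← h0, ← h1]
      simp
  rw [chainSum, h]
  split_ifs <;> simp [chainProd]

/-- Removing the head `j` of a chain leaves a shorter chain with head `l ≤ j`. This is the same
recursion as the binomial expansion of `(1 + X * runSeries s) ^ j`. -/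
theorem chainSum_succ (s i g j : ℕ) (φ : ℕ → ℚ) :
    chainSum (s + 1) i g j φ
      = if j ≤ i then ∑ l ∈ Finset.range (j + 1), (j.choose l : ℚ) * chainSum s (i - j) g l φ
        else 0 := by
  split_ifs with hji
  · simp only [chainSum, Finset.mul_sum]
    rw [Finset.sum_sigma']
    refine Finset.sum_bij' (fun f _ => ⟨f 1, Fin.tail f⟩) (fun p _ => Fin.cons j p.2) ?_ ?_ ?_ ?_ ?_
    · intro f hf
      obtain ⟨h0, h1, h2⟩ := mem_chains.1 hf
      rw [Fin.sum_univ_succ] at h2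
      have := h1 0
      simp only [Fin.succ_zero_eq_one, Fin.castSucc_zero] at this
      simp only [Finset.mem_sigma, Finset.mem_range, mem_chains]
      refine ⟨by omega, rfl, fun t => h1 t.succ, ?_⟩
      simp only [Fin.tail]
      omega
    · rintro ⟨l, f⟩ hf
      simp only [Finset.mem_sigma, Finset.mem_range, mem_chains] at hf
      obtain ⟨hl, h0, h1, h2⟩ := hf
      rw [mem_chains]
      refine ⟨rfl, fun t => ?_, ?_⟩
      · refine Fin.cases ?_ (fun t => ?_) t
        · simp only [Fin.cons_succ, Fin.castSucc_zero, Fin.cons_zero]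
          omega
        · simpa only [Fin.cons_succ, ← Fin.succ_castSucc] using h1 t
      · rw [Fin.sum_univ_succ]
        simp only [Fin.cons_succ, Fin.cons_zero]
        omega
    · intro f hf
      obtain ⟨h0, -, -⟩ := mem_chains.1 hf
      rw [← h0]
      exact Fin.cons_self_tail f
    · rintro ⟨l, f⟩ hf
      simp only [Finset.mem_sigma, mem_chains] at hf
      obtain ⟨-, h0, -, -⟩ := hf
      subst h0
      rfl
    · intro f hf
      obtain ⟨h0, -, -⟩ := mem_chains.1 hf
      rw [chainProd, Fin.prod_univ_succ, ← h0, chainProd]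
      push_cast
      rw [← mul_assoc]
      rfl
  · apply Finset.sum_eq_zero
    intro f hf
    obtain ⟨h0, -, h2⟩ := mem_chains.1 hf
    rw [Fin.sum_univ_succ] at h2
    omega

/-- Absorption `k * C(g, k) = g * C(g - 1, k - 1)` cancels the factor `1 / g`; the remaining sum is
Vandermonde's. -/
theorem lastWeight_eq (g a : ℕ) : lastWeight g a = ((a + g - 1).choose g : ℚ) := by
  unfold lastWeight
  split_ifs with hg
  · simp [hg]
  · obtain ⟨g, rfl⟩ := Nat.exists_eq_succ_of_ne_zero hg
    have hv : ((a + g).choose (g + 1) : ℚ)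
        = ∑ k ∈ Finset.range (g + 1), (a.choose (k + 1) : ℚ) * g.choose k := by
      rw [Nat.add_choose_eq, Finset.Nat.sum_antidiagonal_eq_sum_range_succ
        (fun x y => a.choose x * g.choose y), Finset.sum_range_succ']
      push_cast
      rw [show g.choose (g + 1) = 0 from Nat.choose_eq_zero_of_lt (by omega), Nat.cast_zero,
        mul_zero, add_zero]
      refine Finset.sum_congr rfl fun k hk => ?_
      rw [Finset.mem_range] at hk
      rw [Nat.choose_symm (by omega)]
    rw [Nat.succ_eq_add_one, show a + (g + 1) - 1 = a + g by omega, hv,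
      ← Finset.Ico_add_one_right_eq_Icc, Finset.sum_Ico_eq_sum_range, Nat.add_sub_cancel,
      Finset.mul_sum]
    refine Finset.sum_congr rfl fun k _ => ?_
    have hk : ((g : ℚ) + 1) * g.choose k = (g + 1).choose (k + 1) * (k + 1) := by
      exact_mod_cast Nat.add_one_mul_choose_eq g k
    rw [add_comm 1 k]
    push_cast
    field_simp
    linear_combination -(a.choose (k + 1) : ℚ) * hk

theorem coeffC_eq_coeffXY (s n h j : ℕ) :
    coeffC s n h j = coeffXY n h (PowerSeries.X ^ j * runSeries s ^ j) := by
  rw [coeffC_eq_chainSum]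
  induction s generalizing n j with
  | zero =>
    rw [chainSum_zero, coeffXY_X_pow_mul, coeffXY_runSeries_zero_pow, lastWeight_eq]
    by_cases hn : j + h = n
    · subst hn
      simp
    · rw [if_neg hn]
      split_ifs with h1 h2
      · omega
      · rfl
      · rfl
  | succ s ih =>
    rw [chainSum_succ, coeffXY_X_pow_mul, runSeries_succ_pow, coeffXY_sum]
    simp only [coeffXY_natCast_mul, ih]

theorem coeffXY_runSeries_succ_pow (s n h m : ℕ) :
    coeffXY n h (runSeries (s + 1) ^ m)
      = ∑ j ∈ Finset.range (m + 1), coeffC s n h j * m.choose j := by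
  rw [runSeries_succ_pow, coeffXY_sum]
  refine Finset.sum_congr rfl fun j _ => ?_
  rw [coeffXY_natCast_mul, coeffC_eq_coeffXY, mul_comm]

theorem coeffC_zero (n h j : ℕ) :
    coeffC 0 n h j = if j + h = n then ((n - 1).choose h : ℚ) else 0 := by
  rw [coeffC_eq_chainSum, chainSum_zero, lastWeight_eq]
  split_ifs with hn
  · rw [hn]
  · rfl

theorem coeffC_one_zero (n j : ℕ) :
    coeffC 1 n 0 j = if j ≤ n then (j.choose (n - j) : ℚ) else 0 := by
  rw [coeffC_eq_chainSum, chainSum_succ]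
  split_ifs with hj
  · simp only [chainSum_zero, lastWeight_eq, add_zero, Nat.choose_zero_right, Nat.cast_one,
      mul_ite, mul_one, mul_zero]
    rw [Finset.sum_ite_eq', ite_eq_left_iff]
    intro hn
    rw [Finset.mem_range] at hn
    rw [Nat.choose_eq_zero_of_lt (by omega), Nat.cast_zero]
  · rfl

/-! ### Counting linear words -/

/-- The number of starting points of `r` consecutive ones in a (linear) word. -/
def runCount (r : ℕ) (w : List Bool) : ℕ :=
  ((Finset.range w.length).filter fun i => ∀ t < r, w.getD (i + t) false = true).card

theorem runCount_cons (r : ℕ) (b : Bool) (w : List Bool) :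
    runCount r (b :: w)
      = (if ∀ t < r, (b :: w).getD t false = true then 1 else 0) + runCount r w := by
  have h : (Finset.range (w.length + 1)) = insert 0 ((Finset.range w.length).map
      (addRightEmbedding 1)) := by
    ext i
    cases i <;> simp
  rw [runCount, runCount, List.length_cons, h, Finset.filter_insert, Finset.filter_map]
  simp only [Function.comp_def, addRightEmbedding_apply, zero_add]
  have e : ∀ i t : ℕ, (b :: w).getD (i + 1 + t) false = w.getD (i + t) false := by
    intro i t
    rw [show i + 1 + t = i + t + 1 by omega, List.getD_cons_succ]
  simp only [e]
  split_ifs with h0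
  · rw [Finset.card_insert_of_notMem (by simp), Finset.card_map, add_comm]
  · rw [Finset.card_map, zero_add]

theorem runCount_replicate_append_false (r c : ℕ) (hc : c < r) (w : List Bool) :
    runCount r (List.replicate c true ++ false :: w) = runCount r w := by
  induction c with
  | zero =>
    rw [List.replicate_zero, List.nil_append, runCount_cons, if_neg, zero_add]
    intro h
    simpa using h 0 hc
  | succ c ih =>
    rw [List.replicate_succ, List.cons_append, runCount_cons, if_neg, zero_add, ih (by omega)]
    intro h
    have := h (c + 1) hc
    rw [List.getD_cons_succ, List.getD_append_right _ _ _ _ (by simp)] at this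
    simp at this

theorem runCount_replicate_append_true (s : ℕ) (w : List Bool) :
    runCount (s + 1) (List.replicate s true ++ true :: w)
      = runCount (s + 1) (List.replicate s true ++ w) + 1 := by
  have e : List.replicate s true ++ true :: w = true :: (List.replicate s true ++ w) := by
    rw [← List.cons_append, ← List.replicate_succ, List.replicate_succ', List.append_assoc]
    rfl
  rw [e, runCount_cons, if_pos, add_comm]
  intro t ht
  cases t with
  | zero => rfl
  | succ t =>
    rw [List.getD_cons_succ, List.getD_append _ _ _ _ (by simp; omega)]
    simp [List.getD_eq_getElem?_getD, show t < s by omega]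

theorem runCount_replicate (r c : ℕ) (hc : c < r) :
    runCount r (List.replicate c true) = 0 := by
  rw [runCount, Finset.card_eq_zero, Finset.filter_eq_empty_iff]
  intro i _ h
  have := h c hc
  rw [List.getD_eq_default _ _ (by simp)] at this
  exact absurd this (by simp)

/-- The generating polynomial, by the number of occurrences of `r` consecutive ones in the word
preceded by `c` ones, of the words of length `L` with `n` ones. -/
noncomputable def wordSum (r c L n : ℕ) : Polynomial ℚ :=
  ∑ f : Fin L → Bool, if (List.ofFn f).count true = n then
    Polynomial.X ^ runCount r (List.replicate c true ++ List.ofFn f) else 0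

theorem sum_fin_succ_bool {M : Type*} [AddCommMonoid M] (L : ℕ) (φ : List Bool → M) :
    ∑ f : Fin (L + 1) → Bool, φ (List.ofFn f)
      = ∑ f : Fin L → Bool, φ (false :: List.ofFn f)
        + ∑ f : Fin L → Bool, φ (true :: List.ofFn f) := by
  rw [← (Fin.consEquiv fun _ => Bool).sum_comp, Fintype.sum_prod_type, Fintype.sum_bool, add_comm]
  simp [Fin.consEquiv, List.ofFn_succ]

theorem wordSum_zero (r c n : ℕ) (hc : c < r) : wordSum r c 0 n = if n = 0 then 1 else 0 := by
  simp [wordSum, runCount_replicate r c hc, eq_comm]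

/-- Reading one letter moves a finite automaton whose state `c` is the current run length, capped at
`r - 1`: a zero resets it, a one increments it, and a one at the cap emits a factor `y`. -/
theorem wordSum_succ (r c L n : ℕ) (hc : c < r) :
    wordSum r c (L + 1) n = wordSum r 0 L n
      + if n = 0 then 0 else if c + 1 = r then Polynomial.X * wordSum r c L (n - 1)
        else wordSum r (c + 1) L (n - 1) := by
  rw [wordSum, sum_fin_succ_bool L fun w => if w.count true = n then
    Polynomial.X ^ runCount r (List.replicate c true ++ w) else 0]
  congr 1
  · rw [wordSum]
    refine Finset.sum_congr rfl fun f _ => ?_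
    rw [runCount_replicate_append_false r c hc]
    simp
  · cases n with
    | zero => simp
    | succ n =>
      simp only [List.count_cons_self, Nat.add_right_cancel_iff, Nat.succ_ne_zero, if_false,
        Nat.add_sub_cancel]
      split_ifs with hr
      · subst hr
        rw [wordSum, Finset.mul_sum]
        refine Finset.sum_congr rfl fun f _ => ?_
        rw [runCount_replicate_append_true, pow_succ', mul_ite, mul_zero]
      · rw [wordSum]
        refine Finset.sum_congr rfl fun f _ => ?_
        rw [List.replicate_succ', List.append_assoc]
        rfl

theorem wordSum_eq_zero_of_lt (r c L n : ℕ) (h : L < n) : wordSum r c L n = 0 := by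
  refine Finset.sum_eq_zero fun f _ => if_neg ?_
  have := List.count_le_length (a := true) (l := List.ofFn f)
  rw [List.length_ofFn] at this
  omega

/-- After `s - d` ones, the open run needs `d` more ones before each further one completes a window,
so its continuation has series `runSeries d`. Each of the `L - n` zeros then opens a fresh run. -/
theorem wordSum_eq_coeff (s d L n : ℕ) (hd : d ≤ s) (hn : n ≤ L) :
    wordSum (s + 1) (s - d) L n
      = PowerSeries.coeff n (runSeries d * runSeries s ^ (L - n)) := by
  induction L generalizing d n with
  | zero =>
    obtain rfl : n = 0 := by omega
    rw [wordSum_zero _ _ _ (by omega)]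
    cases d <;> simp [runSeries]
  | succ L ih =>
    -- In `1 + X * ψ`, the term 1 means that the open run ends here, and `X * ψ` that the next
    -- letter is a one.
    obtain ⟨ψ, hψ, hψ'⟩ : ∃ ψ, runSeries d = 1 + PowerSeries.X * ψ ∧ ∀ k ≤ L,
        (if s - d + 1 = s + 1 then Polynomial.X * wordSum (s + 1) (s - d) L k
          else wordSum (s + 1) (s - d + 1) L k)
        = PowerSeries.coeff k (ψ * runSeries s ^ (L - k)) := by
      cases d with
      | zero =>
        refine ⟨_, runSeries_zero_eq, fun k hk => ?_⟩
        rw [if_pos (by omega), ih 0 k hd hk, mul_assoc, PowerSeries.coeff_C_mul]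
      | succ d =>
        refine ⟨_, rfl, fun k hk => ?_⟩
        rw [if_neg (by omega), show s - (d + 1) + 1 = s - d by omega, ih d k (by omega) hk]
    have h0 : wordSum (s + 1) 0 L n = PowerSeries.coeff n (runSeries s ^ (L + 1 - n)) := by
      rcases Nat.lt_or_ge L n with h | h
      · obtain rfl : n = L + 1 := by omega
        rw [wordSum_eq_zero_of_lt _ _ _ _ h, Nat.sub_self, pow_zero, PowerSeries.coeff_one,
          if_neg (by omega)]
      · have := ih s n le_rfl h
        rw [Nat.sub_self] at this
        rw [this, ← pow_succ', show L - n + 1 = L + 1 - n by omega]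
    rw [wordSum_succ _ _ _ _ (by omega), h0, hψ, add_mul, one_mul, map_add, mul_assoc]
    congr 1
    cases n with
    | zero => simp
    | succ n =>
      rw [if_neg (by omega), Nat.add_sub_cancel, hψ' n (by omega), PowerSeries.coeff_succ_X_mul,
        Nat.add_sub_add_right]

/-- The number of words of length `L` with `n` ones that contain exactly `h` times `r` consecutive
ones. -/
def wordCount (r L n h : ℕ) : ℕ :=
  (Finset.univ.filter fun f : Fin L → Bool =>
    (List.ofFn f).count true = n ∧ runCount r (List.ofFn f) = h).card

theorem wordCount_eq_coeffXY (s L n h : ℕ) (hn : n ≤ L) :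
    (wordCount (s + 1) L n h : ℚ) = coeffXY n h (runSeries s ^ (L + 1 - n)) := by
  have := wordSum_eq_coeff s s L n le_rfl hn
  rw [← pow_succ', show L - n + 1 = L + 1 - n by omega, Nat.sub_self] at this
  rw [coeffXY, ← this, wordSum, Polynomial.finsetSum_coeff, wordCount, Finset.card_filter,
    Nat.cast_sum]
  refine Finset.sum_congr rfl fun f _ => ?_
  split_ifs with h1 h2 h2
  · simp [h1.2]
  · exact absurd h1.1 h2
  · simp only [h2, true_and] at h1
    rw [Polynomial.coeff_X_pow, List.replicate_zero, List.nil_append, if_neg (Ne.symm h1),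
      Nat.cast_zero]
  · simp

/-! ### Cyclic sequences and the cut at a zero -/

/-- The number of starting points of `r` consecutive ones in a cyclic binary sequence. -/
def cyclicRunCount (N : ℕ) [NeZero N] (r : ℕ) (S : ZMod N → Bool) : ℕ :=
  (Finset.univ.filter fun i : ZMod N => ∀ t < r, S (i + (t : ZMod N)) = true).card

variable (N : ℕ) [NeZero N]

theorem occurrences_replicate (r : ℕ) (S : ZMod N → Bool) :
    occurrences N (List.replicate r true) S = cyclicRunCount N r S := by
  unfold occurrences cyclicRunCount
  congr 1
  refine Finset.filter_congr fun i _ => ?_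
  simp only [List.get_eq_getElem, List.getElem_replicate]
  constructor
  · intro h t ht
    exact h ⟨t, by simpa using ht⟩
  · intro h t
    exact h t (by simpa using t.2)

theorem cyclicRunCount_one (S : ZMod N → Bool) :
    cyclicRunCount N 1 S = (Finset.univ.filter fun i : ZMod N => S i = true).card := by
  simp [cyclicRunCount]

theorem stringCount_replicate (n r h : ℕ) :
    stringCount N n (List.replicate r true) h
      = (Finset.univ.filter fun S : ZMod N → Bool =>
          cyclicRunCount N 1 S = n ∧ cyclicRunCount N r S = h).card := by
  simp only [stringCount, occurrences_replicate, cyclicRunCount_one]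

theorem genFib_eq_card (r h : ℕ) :
    genFib N r h
      = (Finset.univ.filter fun S : ZMod N → Bool => cyclicRunCount N r S = h).card := by
  classical
  refine Finset.card_bij' (fun Y _ i => decide (i ∈ Y))
    (fun S _ => Finset.univ.filter fun i => S i = true) ?_ ?_ ?_ ?_
  · intro Y hY
    rw [Finset.mem_filter] at hY ⊢
    simpa [cyclicRunCount, consecutiveCount] using hY
  · intro S hS
    rw [Finset.mem_filter] at hS ⊢
    simpa [cyclicRunCount, consecutiveCount] using hS
  · intro Y _
    simp
  · intro S _
    simp

theorem cyclicRunCount_le (r : ℕ) (S : ZMod N → Bool) : cyclicRunCount N r S ≤ N :=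
  (Finset.card_le_univ _).trans_eq (ZMod.card N)

theorem genFib_eq_sum_stringCount (r h : ℕ) :
    genFib N r h
      = ∑ n ∈ Finset.range (N + 1), stringCount N n (List.replicate r true) h := by
  rw [genFib_eq_card, Finset.card_eq_sum_card_fiberwise (f := cyclicRunCount N 1)
    (t := Finset.range (N + 1))]
  · simp only [stringCount_replicate, Finset.filter_filter, and_comm]
  · intro S _
    simpa [Nat.lt_succ_iff] using cyclicRunCount_le N 1 S

theorem card_zeros (S : ZMod N → Bool) :
    (Finset.univ.filter fun i : ZMod N => S i = false).card = N - cyclicRunCount N 1 S := by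
  have := Finset.card_filter_add_card_filter_not (s := (Finset.univ : Finset (ZMod N)))
    (fun i => S i = true)
  rw [Finset.card_univ, ZMod.card] at this
  simp only [Bool.not_eq_true] at this
  rw [cyclicRunCount_one]
  omega

theorem stringCount_self (r h : ℕ) :
    stringCount N N (List.replicate r true) h = if h = N then 1 else 0 := by
  have hall : ∀ S : ZMod N → Bool, cyclicRunCount N 1 S = N ↔ S = fun _ => true := by
    intro S
    have hz := card_zeros N S
    constructor
    · intro hS
      rw [hS, Nat.sub_self, Finset.card_eq_zero, Finset.filter_eq_empty_iff] at hz
      ext1 i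
      simpa using hz (Finset.mem_univ i)
    · rintro rfl
      simp [cyclicRunCount, ZMod.card]
  have htrue : cyclicRunCount N r (fun _ => true) = N := by
    simp [cyclicRunCount, ZMod.card]
  rw [stringCount_replicate]
  simp only [hall]
  split_ifs with h0
  · rw [Finset.card_eq_one]
    refine ⟨fun _ => true, ?_⟩
    ext S
    simp only [Finset.mem_filter, Finset.mem_univ, true_and, Finset.mem_singleton,
      and_iff_left_iff_imp]
    rintro rfl
    rw [htrue, h0]
  · rw [Finset.card_eq_zero, Finset.filter_eq_empty_iff]
    rintro S - ⟨rfl, h1⟩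
    exact h0 (h1.symm.trans htrue)

theorem cyclicRunCount_shift (r : ℕ) (p : ZMod N) (S : ZMod N → Bool) :
    cyclicRunCount N r (fun i => S (i + p)) = cyclicRunCount N r S := by
  refine Finset.card_equiv (Equiv.addRight p) fun i => ?_
  simp [add_right_comm]

theorem card_filter_shift (r n h : ℕ) (p : ZMod N) :
    (Finset.univ.filter fun S : ZMod N → Bool =>
        (cyclicRunCount N 1 S = n ∧ cyclicRunCount N r S = h) ∧ S p = false).card
      = (Finset.univ.filter fun S : ZMod N → Bool =>
        (cyclicRunCount N 1 S = n ∧ cyclicRunCount N r S = h) ∧ S 0 = false).card := by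
  refine Finset.card_equiv ((Equiv.addRight p).arrowCongr (Equiv.refl Bool)).symm fun S => ?_
  have e : ((Equiv.addRight p).arrowCongr (Equiv.refl Bool)).symm S = fun i => S (i + p) := rfl
  simp only [e, Finset.mem_filter, Finset.mem_univ, true_and, cyclicRunCount_shift, zero_add]

/-- Double counting of the zeros of the cyclic sequences. -/
theorem mul_stringCount (r n h : ℕ) :
    (N - n) * stringCount N n (List.replicate r true) h
      = N * (Finset.univ.filter fun S : ZMod N → Bool =>
        (cyclicRunCount N 1 S = n ∧ cyclicRunCount N r S = h) ∧ S 0 = false).card := by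
  have h1 := Finset.sum_card_bipartiteAbove_eq_sum_card_bipartiteBelow
    (s := Finset.univ.filter fun S : ZMod N → Bool =>
      cyclicRunCount N 1 S = n ∧ cyclicRunCount N r S = h)
    (t := (Finset.univ : Finset (ZMod N))) (fun S i => S i = false)
  simp only [Finset.bipartiteAbove, Finset.bipartiteBelow, Finset.filter_filter,
    card_filter_shift, card_zeros, Finset.sum_const, Finset.card_univ, ZMod.card, smul_eq_mul]
    at h1
  rw [← h1, stringCount_replicate, mul_comm, ← smul_eq_mul, ← Finset.sum_const]
  refine Finset.sum_congr rfl fun S hS => ?_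
  rw [(Finset.mem_filter.1 hS).2.1]

theorem card_filter_val (P : ℕ → Prop) [DecidablePred P] :
    (Finset.univ.filter fun i : ZMod N => P i.val).card = ((Finset.range N).filter P).card := by
  refine Finset.card_bij (fun i _ => i.val) ?_ ?_ ?_
  · intro i hi
    simpa [ZMod.val_lt] using hi
  · intro i _ j _ hij
    exact ZMod.val_injective N hij
  · intro i hi
    rw [Finset.mem_filter, Finset.mem_range] at hi
    exact ⟨(i : ZMod N), by simpa [ZMod.val_natCast_of_lt hi.1] using hi.2,
      ZMod.val_natCast_of_lt hi.1⟩

theorem cyclicRunCount_getD (r : ℕ) (hr : 0 < r) (w : List Bool) (hw : w.length + 1 = N) :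
    cyclicRunCount N r (fun i => (false :: w).getD i.val false) = runCount r w := by
  have h0 : runCount r (false :: w) = runCount r w := by
    simpa using runCount_replicate_append_false r 0 hr w
  rw [← h0, runCount, List.length_cons, hw, ← card_filter_val N, cyclicRunCount]
  congr 1
  refine Finset.filter_congr fun i _ => ?_
  have hi := ZMod.val_lt i
  have hv : ∀ t : ℕ, (i + (t : ZMod N)).val = (i.val + t) % N := by
    intro t
    rw [ZMod.val_add, ZMod.val_natCast, Nat.add_mod_mod]
  simp only [hv]
  constructor
  · intro h t ht
    have hlt : i.val + t < N := by
      by_contra hge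
      -- A window that wraps around would contain the zero at position 0.
      have := h (N - i.val) (by omega)
      rw [show i.val + (N - i.val) = N by omega, Nat.mod_self] at this
      simp at this
    rw [← Nat.mod_eq_of_lt hlt]
    exact h t ht
  · intro h t ht
    have hlt : i.val + t < N := by
      by_contra hge
      -- In the linear word, a window running past the end reads the default `false`.
      have := h t ht
      rw [List.getD_eq_default _ _ (by rw [List.length_cons]; omega)] at this
      simp at this
    rw [Nat.mod_eq_of_lt hlt]
    exact h t ht

theorem runCount_one (w : List Bool) : runCount 1 w = w.count true := by
  induction w with
  | nil => rfl
  | cons b w ih =>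
    rw [runCount_cons, ih]
    cases b <;> simp [add_comm]

theorem card_filter_apply_zero_eq_wordCount (r n h : ℕ) (hr : 0 < r) :
    (Finset.univ.filter fun S : ZMod N → Bool =>
        (cyclicRunCount N 1 S = n ∧ cyclicRunCount N r S = h) ∧ S 0 = false).card
      = wordCount r (N - 1) n h := by
  have hN : N - 1 + 1 = N := Nat.sub_add_cancel NeZero.one_le
  have hc : ∀ (q : ℕ), 0 < q → ∀ f : Fin (N - 1) → Bool,
      cyclicRunCount N q (fun i => (false :: List.ofFn f).getD i.val false)
        = runCount q (List.ofFn f) := fun q hq f =>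
    cyclicRunCount_getD N q hq _ (by rw [List.length_ofFn, hN])
  have hinv : ∀ S : ZMod N → Bool, S 0 = false →
      (fun i : ZMod N => (false :: List.ofFn fun v : Fin (N - 1) =>
        S ((v + 1 : ℕ) : ZMod N)).getD i.val false) = S := by
    intro S hS
    ext1 i
    have hi := ZMod.val_lt i
    rcases Nat.eq_zero_or_pos i.val with h | h
    · rw [h, (ZMod.val_eq_zero i).1 h, hS]
      rfl
    · obtain ⟨k, hk⟩ := Nat.exists_eq_succ_of_ne_zero h.ne'
      rw [hk, Nat.succ_eq_add_one, List.getD_cons_succ,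
        List.getD_eq_getElem _ _ (by rw [List.length_ofFn]; omega), List.getElem_ofFn]
      simp only
      rw [← Nat.succ_eq_add_one, ← hk, ZMod.natCast_zmod_val]
  symm
  refine Finset.card_bij' (fun f _ i => (false :: List.ofFn f).getD i.val false)
    (fun S _ v => S ((v + 1 : ℕ) : ZMod N)) ?_ ?_ ?_ ?_
  · intro f hf
    simp only [Finset.mem_filter, Finset.mem_univ, true_and] at hf ⊢
    rw [hc 1 one_pos, hc r hr, runCount_one]
    exact ⟨hf, by simp⟩
  · intro S hS
    simp only [Finset.mem_filter, Finset.mem_univ, true_and] at hS ⊢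
    rw [← runCount_one, ← hc 1 one_pos, ← hc r hr, hinv S hS.2]
    exact hS.1
  · intro f _
    ext1 v
    have hv := v.2
    simp only
    rw [ZMod.val_natCast_of_lt (by omega), List.getD_cons_succ,
      List.getD_eq_getElem _ _ (by rw [List.length_ofFn]; omega), List.getElem_ofFn]
  · intro S hS
    exact hinv S (Finset.mem_filter.1 hS).2.2

theorem stringCount_eq (s n h : ℕ) (hn : n < N) :
    (stringCount N n (List.replicate (s + 2) true) h : ℚ)
      = N * ∑ j ∈ Finset.range (N - n + 1),
          coeffC s n h j / ((N : ℚ) - n) * ((N - n).choose j : ℚ) := by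
  have h1 := mul_stringCount N (s + 2) n h
  rw [card_filter_apply_zero_eq_wordCount N _ _ _ (by omega)] at h1
  have h2 := wordCount_eq_coeffXY (s + 1) (N - 1) n h (by omega)
  rw [show N - 1 + 1 - n = N - n by omega, coeffXY_runSeries_succ_pow] at h2
  have h3 : ((N : ℚ) - n) * stringCount N n (List.replicate (s + 2) true) h
      = N * wordCount (s + 2) (N - 1) n h := by
    rw [← Nat.cast_sub hn.le]
    exact_mod_cast h1
  rw [h2] at h3
  have h4 : (N : ℚ) - n ≠ 0 := sub_ne_zero.2 (by exact_mod_cast hn.ne')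
  rw [← mul_right_inj' h4, h3, Finset.mul_sum, Finset.mul_sum, Finset.mul_sum]
  refine Finset.sum_congr rfl fun j _ => ?_
  field_simp

/-! ### The formulas for `F` -/

theorem genFib_eq (s h : ℕ) :
    (genFib N (s + 2) h : ℚ)
      = (N : ℚ) * (∑ n ∈ Finset.range N, ∑ j ∈ Finset.range (N - n + 1),
          coeffC s n h j / ((N : ℚ) - n) * ((N - n).choose j : ℚ))
        + (if h = N then 1 else 0) := by
  rw [genFib_eq_sum_stringCount, Finset.sum_range_succ, stringCount_self, Nat.cast_add,
    Nat.cast_sum, Finset.mul_sum]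
  congr 1
  · refine Finset.sum_congr rfl fun n hn => ?_
    exact stringCount_eq N s n h (Finset.mem_range.1 hn)
  · split_ifs <;> simp

theorem genFib_two (h : ℕ) :
    (genFib N 2 h : ℚ)
      = (∑ n ∈ Finset.Icc (h + 1) ((N + h) / 2),
          (((n : ℚ) - h) * N) / (((N : ℚ) - n) * n)
            * ((N - n).choose (n - h) : ℚ) * (n.choose h : ℚ))
        + (if h = 0 then 1 else 0) + (if h = N then 1 else 0) := by
  have hN : 0 < N := NeZero.pos N
  have hinner : ∀ n ∈ Finset.range N, ∑ j ∈ Finset.range (N - n + 1),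
      coeffC 0 n h j / ((N : ℚ) - n) * ((N - n).choose j : ℚ)
      = if h ≤ n then ((n - 1).choose h : ℚ) / ((N : ℚ) - n) * ((N - n).choose (n - h) : ℚ)
        else 0 := by
    intro n _
    simp only [coeffC_zero]
    split_ifs with hn
    · rw [Finset.sum_eq_single (n - h)]
      · rw [if_pos (by omega)]
      · intro j _ hj
        rw [if_neg (by omega)]
        simp
      · intro hj
        rw [Finset.mem_range] at hj
        rw [Nat.choose_eq_zero_of_lt (show N - n < n - h by omega)]
        simp
    · refine Finset.sum_eq_zero fun j _ => ?_
      rw [if_neg (by omega)]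
      simp
  -- The term `n = 0` is split off; it becomes `[h = 0]`.
  rw [genFib_eq N 0 h, Finset.sum_congr rfl hinner, Finset.range_eq_Ico,
    Finset.sum_eq_sum_Ico_succ_bot hN, mul_add, add_comm (_ * _)]
  congr 2
  · rw [Finset.mul_sum]
    symm
    refine Finset.sum_subset_zero_on_sdiff ?_ ?_ ?_
    · intro n hn
      rw [Finset.mem_Icc] at hn
      rw [Finset.mem_Ico]
      omega
    · intro n hn
      rw [Finset.mem_sdiff, Finset.mem_Ico, Finset.mem_Icc] at hn
      split_ifs with hhn
      · rcases hhn.eq_or_lt with rfl | hlt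
        · rw [Nat.choose_eq_zero_of_lt (show h - 1 < h by omega)]
          simp
        · rw [Nat.choose_eq_zero_of_lt (show N - n < n - h by omega)]
          simp
      · simp
    · intro n hn
      rw [Finset.mem_Icc] at hn
      rw [if_pos (by omega)]
      obtain ⟨m, rfl⟩ : ∃ m, n = m + 1 := ⟨n - 1, by omega⟩
      -- `C(n - 1, h) * n = C(n, h) * (n - h)` turns the coefficient into the stated fraction.
      have hc : (m.choose h : ℚ) * (m + 1) = (m + 1).choose h * ((m + 1 : ℕ) - h) := by
        rw [← Nat.cast_sub (by omega)]
        exact_mod_cast Nat.choose_mul_succ_eq m h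
      have h4 : (N : ℚ) - (m + 1 : ℕ) ≠ 0 := sub_ne_zero.2 (by norm_cast; omega)
      rw [Nat.add_sub_cancel]
      push_cast at hc h4 ⊢
      field_simp
      linear_combination -((N - (m + 1)).choose (m + 1 - h) : ℚ) * hc
  · rcases Nat.eq_zero_or_pos h with rfl | hh
    · have : (N : ℚ) ≠ 0 := by exact_mod_cast hN.ne'
      simp [this]
    · rw [if_neg (by omega), if_neg (by omega), mul_zero]

theorem genFib_two_zero :
    (genFib N 2 0 : ℚ)
      = 1 + ∑ n ∈ Finset.Icc 1 (N / 2), (N : ℚ) / ((N : ℚ) - n) * ((N - n).choose n : ℚ) := by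
  rw [genFib_two, if_pos rfl, if_neg (NeZero.ne' N), add_zero, add_comm]
  congr 1
  refine Finset.sum_congr rfl fun n hn => ?_
  rw [Finset.mem_Icc] at hn
  have h1 : (n : ℚ) ≠ 0 := by norm_cast; omega
  simp only [Nat.cast_zero, sub_zero, Nat.sub_zero, Nat.choose_zero_right, Nat.cast_one, mul_one]
  rw [mul_comm (n : ℚ) N, mul_div_mul_right _ _ h1]

theorem genFib_three_zero :
    (genFib N 3 0 : ℚ)
      = (N : ℚ) * ∑ n ∈ Finset.range N, ∑ j ∈ Finset.Icc (n / 2) (N - n),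
          coeffC 1 n 0 j / ((N : ℚ) - n) * ((N - n).choose j : ℚ) := by
  rw [genFib_eq N 1 0, if_neg (NeZero.ne' N), add_zero]
  congr 1
  refine Finset.sum_congr rfl fun n _ => ?_
  symm
  refine Finset.sum_subset ?_ ?_
  · intro j hj
    rw [Finset.mem_Icc] at hj
    rw [Finset.mem_range]
    omega
  · intro j hj hj'
    rw [Finset.mem_range] at hj
    rw [Finset.mem_Icc] at hj'
    rw [coeffC_one_zero, Nat.choose_eq_zero_of_lt (show j < n - j by omega)]
    simp

/-- The summand 1 is the term `n = 0`. The filter `j ≤ n` is essential: for `j > n` truncated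
subtraction would make `C(j, n - j)` equal to 1 instead of 0. When `n + n / 2 > N` the range of `j`
is empty. -/
theorem genFib_three_zero_eq_choose :
    (genFib N 3 0 : ℚ)
      = 1 + (N : ℚ) * ∑ n ∈ (Finset.Ico 1 N).filter (fun n => n + n / 2 ≤ N),
          ∑ j ∈ (Finset.Icc (n / 2) (N - n)).filter (fun j => j ≤ n),
            ((j.choose (n - j) : ℚ) * ((N - n).choose j : ℚ)) / ((N : ℚ) - n) := by
  have hN : 0 < N := NeZero.pos N
  have hN' : (N : ℚ) ≠ 0 := by exact_mod_cast hN.ne'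
  rw [genFib_three_zero, Finset.range_eq_Ico, Finset.sum_eq_sum_Ico_succ_bot hN, mul_add]
  congr 1
  · rw [Finset.sum_eq_single 0]
    · simp [coeffC_one_zero, hN']
    · intro j _ hj
      rw [coeffC_one_zero, if_neg (by omega)]
      simp
    · simp
  · congr 1
    rw [Finset.sum_filter]
    refine Finset.sum_congr rfl fun n hn => ?_
    rw [Finset.mem_Ico] at hn
    split_ifs with hle
    · rw [Finset.sum_filter]
      refine Finset.sum_congr rfl fun j _ => ?_
      rw [coeffC_one_zero]
      split_ifs
      · ring
      · simp
    · rw [Finset.Icc_eq_empty (by omega), Finset.sum_empty]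

end BinarySeq

theorem mainTheorem11 (N : ℕ) [NeZero N] :
    (∀ r h : ℕ, 2 ≤ r →
      BinarySeq.genFib N r h
          = ∑ n ∈ Finset.range (N + 1),
              BinarySeq.stringCount N n (List.replicate r true) h ∧
      (BinarySeq.genFib N r h : ℚ)
          = (N : ℚ) * (∑ n ∈ Finset.range N, ∑ j ∈ Finset.range (N - n + 1),
              BinarySeq.coeffC (r - 2) n h j / ((N : ℚ) - n) * ((N - n).choose j : ℚ))
            + (if h = N then 1 else 0)) ∧
    (∀ h : ℕ,
      (BinarySeq.genFib N 2 h : ℚ)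
          = (∑ n ∈ Finset.Icc (h + 1) ((N + h) / 2),
              (((n : ℚ) - h) * N) / (((N : ℚ) - n) * n)
                * ((N - n).choose (n - h) : ℚ) * (n.choose h : ℚ))
            + (if h = 0 then 1 else 0) + (if h = N then 1 else 0)) ∧
    (BinarySeq.genFib N 2 0 : ℚ)
        = 1 + ∑ n ∈ Finset.Icc 1 (N / 2), (N : ℚ) / ((N : ℚ) - n) * ((N - n).choose n : ℚ) ∧
    (BinarySeq.genFib N 3 0 : ℚ)
        = (N : ℚ) * ∑ n ∈ Finset.range N, ∑ j ∈ Finset.Icc (n / 2) (N - n),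
            BinarySeq.coeffC 1 n 0 j / ((N : ℚ) - n) * ((N - n).choose j : ℚ) ∧
    (BinarySeq.genFib N 3 0 : ℚ)
        = 1 + (N : ℚ) * ∑ n ∈ (Finset.Ico 1 N).filter (fun n => n + n / 2 ≤ N),
            ∑ j ∈ (Finset.Icc (n / 2) (N - n)).filter (fun j => j ≤ n),
              ((j.choose (n - j) : ℚ) * ((N - n).choose j : ℚ)) / ((N : ℚ) - n) :=
  ⟨fun r h hr => ⟨BinarySeq.genFib_eq_sum_stringCount N r h, by
      obtain ⟨s, rfl⟩ := Nat.exists_eq_add_of_le' hr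
      exact BinarySeq.genFib_eq N s h⟩,
    BinarySeq.genFib_two N, BinarySeq.genFib_two_zero N, BinarySeq.genFib_three_zero N,
    BinarySeq.genFib_three_zero_eq_choose N⟩
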